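/- **Conventions.** A map $s:S\times S\to S\times S$ on a nonempty set $S$ is a solution to the Pentagon Equation (PE) if $s_{23}s_{13}s_{12}=s_{12}s_{23}$ on $S^3$, where $s_{ij}$ applies $s$ to components $i,j$; it is bijective if $s$ is a bijection, and finite if $S$ is finite. Write $s(x,y)=(x\cdot y,\theta_x(y))$. An isomorphism $(S,s)\to(T,t)$ is a bijection $f:S\to T$ with $(f\times f)s=t(f\times f)$. A matched pair of groups $(A,G,\sigma,\delta)$ consists of groups $A,G$, a left action $\sigma:A\to\operatorname{Sym}(G)$ and a right action $\delta:G\to\operatorname{Sym}(A)$ (so $\delta_{xy}=\delta_y\delta_x$) with $\sigma_a(xy)=\sigma_a(x)\,\sigma_{\delta_x(a)}(y)$ and $\delta_x(ab)=\delta_{\sigma_b(x)}(a)\,\delta_x(b)$. An isomorphism of matched pairs $(A,G,\sigma,\delta)\to(A',G',\sigma',\delta')$ is a pair of group isomorphisms $f_1:A\to A'$, $f_2:G\to G'$ with $f_2(\sigma_a(x))=\sigma'_{f_1(a)}(f_2(x))$ and $f_1(\delta_x(a))=\delta'_{f_2(x)}(f_1(a))$. For a finite bijective solution $(S,s)$ let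 $E=\{e\in S: e\cdot e=e\}$, fix $e_0\in E$, and put $1=\theta_{e_0}(e_0)$, $G_1=1\cdot S$. The retract of $(S,s)$ is the set $\overline S=S/{\approx}$ with the map $\overline s$ induced by $s$, where, for $e,f\in E$ and $g,h\in G_1$, $e\cdot g\approx f\cdot h$ if and only if $\theta_e=\theta_f$ and $g=h$. **Theorem.** (1) Let $(A,G,\sigma,\delta)$ be a matched pair of groups (finite or not), $X$ a nonempty set and $(\varphi_a)_{a\in A}$ a family of permutations of $X$. Then $$s\big((\alpha,a,x),(\beta,b,y)\big)=\Big((\alpha,a,xy),\ \big(\varphi^{-1}_{b(\delta_x(a))^{-1}}\varphi_b(\beta),\ b(\delta_x(a))^{-1},\ \sigma_{\delta_x(a)}(y)\big)\Big)$$ defines a bijective solution to the PE on $X\times A\times G$; denote it by $\operatorname{Ext}_X^{\varphi}(A,G,\sigma,\delta)$. (2) Let $(S,s)$ be a finite bijective solution to the PE. Then $E\neq\emptyset$, and for every choice of $e_0\in E$ the relation $\approx$ is an equivalence relation on $S$ and $s$ induces a bijective solution $\overline s$ on $\overline S$. There are a matched pair $(A,G,\sigma,\delta)$, a nonempty set $X$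 and permutations $(\varphi_a)_{a\in A}$ of $X$ such that $(S,s)$ is isomorphic to $\operatorname{Ext}_X^{\varphi}(A,G,\sigma,\delta)$, and the matched pair is determined by the retract, as follows. A matched pair $(A,G,\sigma,\delta)$ occurs in such a description of $(S,s)$ if and only if $(\overline S,\overline s)$ is isomorphic to the solution $$\big((a,x),(b,y)\big)\mapsto\big((a,xy),\ (b(\delta_x(a))^{-1},\ \sigma_{\delta_x(a)}(y))\big)$$ on $A\times G$, and any two matched pairs with this property are isomorphic. (3) If $(S,s)$ and $(S',s')$ are finite bijective solutions to the PE, isomorphic to $\operatorname{Ext}_X^{\varphi}(A,G,\sigma,\delta)$ and $\operatorname{Ext}_{X'}^{\varphi'}(A',G',\sigma',\delta')$ respectively, with $X,X'$ nonempty, then $(S,s)$ and $(S',s')$ are isomorphic if and only if the matched pairs $(A,G,\sigma,\delta)$ and $(A',G',\sigma',\delta')$ are isomorphic and $|X|=|X'|$. -/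

import Mathlib

universe u v w x u' v' w' x'

namespace Pentagon

/-! ## Set-theoretic solutions to the Pentagon Equation -/

section Solutions

variable {S : Type u} {T : Type v}

/-- `s₁₂` applies `s` to the first two components. -/
def map12 (s : S × S → S × S) : S × S × S → S × S × S :=
  fun p => ((s (p.1, p.2.1)).1, (s (p.1, p.2.1)).2, p.2.2)

/-- `s₁₃` applies `s` to the first and third components. -/
def map13 (s : S × S → S × S) : S × S × S → S × S × S :=
  fun p => ((s (p.1, p.2.2)).1, p.2.1, (s (p.1, p.2.2)).2)

/-- `s₂₃` applies `s` to the last two components. -/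
def map23 (s : S × S → S × S) : S × S × S → S × S × S :=
  fun p => (p.1, s p.2)

/-- The set-theoretic Pentagon Equation `s₂₃ s₁₃ s₁₂ = s₁₂ s₂₃`. -/
def IsSolution (s : S × S → S × S) : Prop :=
  map23 s ∘ map13 s ∘ map12 s = map12 s ∘ map23 s

/-- Homomorphisms of solutions: `(f × f) ∘ s = t ∘ (f × f)`. -/
def IsHom (s : S × S → S × S) (t : T × T → T × T) (f : S → T) : Prop :=
  Prod.map f f ∘ s = t ∘ Prod.map f f

/-- A bijective homomorphism of solutions. -/
def IsIso (s : S × S → S × S) (t : T × T → T × T) (f : S → T) : Prop :=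
  Function.Bijective f ∧ IsHom s t f

/-- Two solutions are isomorphic if there is a bijective homomorphism between them. -/
def Isomorphic (s : S × S → S × S) (t : T × T → T × T) : Prop :=
  ∃ f : S → T, IsIso s t f

/-- The multiplication `x · y` of `s(x, y) = (x · y, θ_x(y))`. -/
def mul (s : S × S → S × S) (x y : S) : S := (s (x, y)).1

/-- The map `θ_x` of `s(x, y) = (x · y, θ_x(y))`. -/
def theta (s : S × S → S × S) (x : S) : S → S := fun y => (s (x, y)).2

/-- The set `E(S, ·)` of idempotents. -/
def idempotents (s : S × S → S × S) : Set S := {e | mul s e e = e}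

/-- `G₁ = 1 · S`, where `1 = θ_{e₀}(e₀)` for the fixed idempotent `e₀`. -/
def G₁ (s : S × S → S × S) (e₀ : S) : Set S :=
  Set.range (mul s (theta s e₀ e₀))

/-- The relation defining the retract: for `e, f ∈ E(S, ·)` and `g, h ∈ G₁`,
`e · g ≈ f · h` if `θ_e = θ_f` and `g = h`. -/
def RetractRel (s : S × S → S × S) (e₀ : S) (x y : S) : Prop :=
  ∃ e ∈ idempotents s, ∃ f ∈ idempotents s, ∃ g ∈ G₁ s e₀, ∃ h ∈ G₁ s e₀,
    x = mul s e g ∧ y = mul s f h ∧ theta s e = theta s f ∧ g = h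

/-- The underlying set `S / ≈` of the retract. -/
def Retract (s : S × S → S × S) (e₀ : S) : Type u := Quot (RetractRel s e₀)

/-- The projection `S → S / ≈`. -/
def Retract.proj (s : S × S → S × S) (e₀ : S) : S → Retract s e₀ := Quot.mk _

end Solutions

/-! ## Matched pairs of groups -/

/-- A matched pair of groups `(A, G, σ, δ)`: a left action `σ` of `A` on the set `G` and a right
action `δ` of `G` on the set `A`, subject to the two compatibility conditions. -/
structure MatchedPair (A : Type v) (G : Type w) [Group A] [Group G] where
  /-- the left action `σ : A → Sym(G)` -/
  σ : A → Equiv.Perm G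
  /-- the right action `δ : G → Sym(A)` -/
  δ : G → Equiv.Perm A
  σ_one : σ 1 = 1
  σ_mul : ∀ a b : A, ∀ x : G, σ (a * b) x = σ a (σ b x)
  δ_one : δ 1 = 1
  δ_mul : ∀ x y : G, ∀ a : A, δ (x * y) a = δ y (δ x a)
  σ_apply_mul : ∀ (a : A) (x y : G), σ a (x * y) = σ a x * σ (δ x a) y
  δ_apply_mul : ∀ (x : G) (a b : A), δ x (a * b) = δ (σ b x) a * δ x b

namespace MatchedPair

variable {A : Type v} {G : Type w} [Group A] [Group G]

/-- The map on `A × G` associated with a matched pair: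
`((a, x), (b, y)) ↦ ((a, x y), (b δ_x(a)⁻¹, σ_{δ_x(a)}(y)))`. -/
def sol (M : MatchedPair A G) : (A × G) × (A × G) → (A × G) × (A × G) :=
  fun ((a, x), (b, y)) => ((a, x * y), (b * (M.δ x a)⁻¹, M.σ (M.δ x a) y))

/-- The map on `X × A × G` associated with a matched pair and permutations `φ_a` of `X`. -/
def ext (M : MatchedPair A G) {X : Type x} (φ : A → Equiv.Perm X) :
    (X × A × G) × (X × A × G) → (X × A × G) × (X × A × G) :=
  fun ((α, a, x), (β, b, y)) =>
    ((α, a, x * y),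
      ((φ (b * (M.δ x a)⁻¹)).symm (φ b β), b * (M.δ x a)⁻¹, M.σ (M.δ x a) y))

/-- Isomorphism of matched pairs. -/
def Isomorphic (M : MatchedPair A G) {A' : Type v'} {G' : Type w'} [Group A'] [Group G']
    (M' : MatchedPair A' G') : Prop :=
  ∃ (f₁ : A ≃* A') (f₂ : G ≃* G'),
    (∀ a x, f₂ (M.σ a x) = M'.σ (f₁ a) (f₂ x)) ∧
    (∀ a x, f₁ (M.δ x a) = M'.δ (f₂ x) (f₁ a))

end MatchedPair

end Pentagon

/-! The flipped inverse `dual s` is again a solution, so a bijective solution carries two semigroup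
laws, `⬝` and `⋆`, and every lemma has a dual. If `S` is finite, an idempotent `e` yields a point `o
= θ e e` with `s (o, o) = (o, o)`. Counting makes right ideals prime (`mem_of_mul_mem`), which
forces `o` to be the only idempotent of `o ⬝ S` (`eq_of_idempotent`). Hence `o ⬝ S` is a group `G`,
and dually `o ⋆ S` is a group `A`. Each element is uniquely `(d ⋆ a) ⬝ g` with `a ∈ A`, `g ∈ G` and
`o ⬝ d = o = o ⋆ d`; in these coordinates `s` is `ext` with trivial `φ` (`exists_isIso_ext`).

For the classification, `(α, a, x) ↦ (φ a α, a, x)` untwists any family `φ`, so only the size of `X`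
matters (`MatchedPair.Isomorphic.ext`). The retract forgets exactly `X` (`retractRel_ext_iff`), and
the solution on `A × G` remembers the matched pair (`MatchedPair.Isomorphic.of_sol`). The size of
`X` is then found by counting. -/

namespace Pentagon

/-! ### The flipped inverse of a solution and the mixed identities. -/

section Dual

variable {S : Type u}

/-- The solution `τ s⁻¹ τ`, where `τ` is the flip. -/
def dual (s : S × S ≃ S × S) : S × S ≃ S × S :=
  ((Equiv.prodComm S S).trans s.symm).trans (Equiv.prodComm S S)

variable {s : S × S ≃ S × S}

local infixl:70 " ⬝ " => mul s
local infixl:70 " ⋆ " => mul (dual s)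
local notation "θ" => theta s
local notation "ψ" => theta (dual s)

theorem apply_eq (x y : S) : s (x, y) = (x ⬝ y, θ x y) := rfl

theorem theta_star_mul (x y : S) : θ x y ⋆ (x ⬝ y) = y :=
  congrArg Prod.snd (s.symm_apply_apply (x, y))

theorem dual_theta_theta_mul (x y : S) : ψ (θ x y) (x ⬝ y) = x :=
  congrArg Prod.fst (s.symm_apply_apply (x, y))

theorem dual_theta_mul_star (w z : S) : ψ w z ⬝ (w ⋆ z) = z :=
  congrArg Prod.fst (s.apply_symm_apply (z, w))

theorem theta_dual_theta_star (w z : S) : θ (ψ w z) (w ⋆ z) = w :=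
  congrArg Prod.snd (s.apply_symm_apply (z, w))

theorem dual_apply_of_apply {x y z w : S} (h : s (x, y) = (z, w)) : dual s (w, z) = (y, x) := by
  have h' : s.symm (z, w) = (x, y) := by rw [← h, s.symm_apply_apply]
  exact congrArg Prod.swap h'

variable (hs : IsSolution s)
include hs

theorem IsSolution.eqs (x y z : S) :
    (x ⬝ y) ⬝ z = x ⬝ (y ⬝ z) ∧ θ x y ⬝ θ (x ⬝ y) z = θ x (y ⬝ z) ∧
      θ (θ x y) (θ (x ⬝ y) z) = θ y z := by
  have h := congrFun hs (x, y, z)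
  simpa [map12, map13, map23, Prod.ext_iff, mul, theta] using h

theorem IsSolution.mul_assoc (x y z : S) : (x ⬝ y) ⬝ z = x ⬝ (y ⬝ z) := (hs.eqs x y z).1

theorem IsSolution.theta_mul (x y z : S) : θ x (y ⬝ z) = θ x y ⬝ θ (x ⬝ y) z :=
  (hs.eqs x y z).2.1.symm

theorem IsSolution.theta_theta (x y z : S) : θ (θ x y) (θ (x ⬝ y) z) = θ y z := (hs.eqs x y z).2.2

theorem IsSolution.theta_star (y x z : S) : θ (y ⋆ x) z = θ y (θ x z) := by
  have h := hs.theta_theta (ψ y x) (y ⋆ x) z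
  rw [theta_dual_theta_star, dual_theta_mul_star] at h
  exact h.symm

/-- Since `s (ψ z y, z ⋆ y) = (y, z)`, the pentagon at `(x, ψ z y, z ⋆ y)` says that `s` maps the
pair of left-hand sides to `(θ x y, z)`; inverting `s` gives both equalities. -/
theorem IsSolution.mixed (x y z : S) :
    θ x (ψ z y) = ψ z (θ x y) ∧ θ (x ⬝ ψ z y) (z ⋆ y) = z ⋆ θ x y := by
  have h1 := hs.theta_mul x (ψ z y) (z ⋆ y)
  have h2 := hs.theta_theta x (ψ z y) (z ⋆ y)
  rw [dual_theta_mul_star] at h1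
  rw [theta_dual_theta_star] at h2
  have h3 := dual_theta_theta_mul (s := s) (θ x (ψ z y)) (θ (x ⬝ ψ z y) (z ⋆ y))
  have h4 := theta_star_mul (s := s) (θ x (ψ z y)) (θ (x ⬝ ψ z y) (z ⋆ y))
  rw [h2, ← h1] at h3 h4
  exact ⟨h3.symm, h4.symm⟩

theorem IsSolution.theta_comm (x y z : S) : θ x (ψ z y) = ψ z (θ x y) := (hs.mixed x y z).1

theorem IsSolution.star_theta (x y z : S) : z ⋆ θ x y = θ (x ⬝ ψ z y) (z ⋆ y) :=
  (hs.mixed x y z).2.symm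

theorem IsSolution.mixed' (x y z : S) :
    ψ (y ⬝ θ x z) (x ⬝ z) = ψ y x ∧ (y ⬝ θ x z) ⋆ (x ⬝ z) = (y ⋆ x) ⬝ z := by
  have h : s (ψ y x, (y ⋆ x) ⬝ z) = (x ⬝ z, y ⬝ θ x z) := by
    rw [apply_eq, ← hs.mul_assoc, hs.theta_mul, dual_theta_mul_star, theta_dual_theta_star]
  have h' := Prod.ext_iff.1 (dual_apply_of_apply h)
  exact ⟨h'.2, h'.1⟩

theorem IsSolution.dual_theta_mul (x y z : S) : ψ (y ⬝ θ x z) (x ⬝ z) = ψ y x :=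
  (hs.mixed' x y z).1

theorem IsSolution.star_mul (y x z : S) : (y ⋆ x) ⬝ z = (y ⬝ θ x z) ⋆ (x ⬝ z) :=
  (hs.mixed' x y z).2.symm

/-- Inverting the pentagon reverses the order of the factors, and exchanging components 1 and 3
restores it. -/
theorem IsSolution.dual : IsSolution (dual s) := by
  have key : ∀ x y z : S, (x ⋆ y) ⋆ z = x ⋆ (y ⋆ z) ∧ ψ x y ⋆ ψ (x ⋆ y) z = ψ x (y ⋆ z) ∧
      ψ (ψ x y) (ψ (x ⋆ y) z) = ψ y z := by
    intro x y z
    obtain ⟨h1, h2, h3⟩ := hs.eqs (ψ (ψ x y) (ψ (x ⋆ y) z)) (ψ x y ⋆ ψ (x ⋆ y) z) ((x ⋆ y) ⋆ z)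
    simp only [dual_theta_mul_star, theta_dual_theta_star] at h1 h2 h3
    have e1 := dual_theta_theta_mul (s := s) (ψ x y ⋆ ψ (x ⋆ y) z) ((x ⋆ y) ⋆ z)
    have e2 := theta_star_mul (s := s) (ψ x y ⋆ ψ (x ⋆ y) z) ((x ⋆ y) ⋆ z)
    have e3 := dual_theta_theta_mul (s := s) (ψ (ψ x y) (ψ (x ⋆ y) z))
      ((ψ x y ⋆ ψ (x ⋆ y) z) ⬝ ((x ⋆ y) ⋆ z))
    have e4 := theta_star_mul (s := s) (ψ (ψ x y) (ψ (x ⋆ y) z))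
      ((ψ x y ⋆ ψ (x ⋆ y) z) ⬝ ((x ⋆ y) ⋆ z))
    rw [← h1, ← h2] at e3 e4
    rw [← h3] at e1 e2
    rw [← e4] at e1 e2
    exact ⟨e2.symm, e1.symm, e3.symm⟩
  funext ⟨x, y, z⟩
  obtain ⟨h1, h2, h3⟩ := key x y z
  exact Prod.ext h1 (Prod.ext h2 h3)

end Dual

end Pentagon

namespace Pentagon

/-! ### Structure of finite bijective solutions. -/

section Structure

variable {S : Type u} {s : S × S ≃ S × S}

local infixl:70 " ⬝ " => mul s
local infixl:70 " ⋆ " => mul (dual s)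
local notation "θ" => theta s
local notation "ψ" => theta (dual s)

theorem IsSolution.apply_theta_self (hs : IsSolution s) {e : S} (he : e ⬝ e = e) :
    s (θ e e, θ e e) = (θ e e, θ e e) := by
  have h1 : ψ (θ e e) e = e := by
    have := dual_theta_theta_mul (s := s) e e
    rwa [he] at this
  have h2 : θ e e ⋆ e = e := by
    have := theta_star_mul (s := s) e e
    rwa [he] at this
  have h3 : ψ (θ e e) (θ e e) = θ e e := by rw [← hs.theta_comm, h1]
  have h4 : θ e e ⋆ θ e e = θ e e := by rw [hs.star_theta, h1, he, h2]
  have h5 := dual_theta_mul_star (s := s) (θ e e) (θ e e)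
  have h6 := theta_dual_theta_star (s := s) (θ e e) (θ e e)
  rw [h3, h4] at h5 h6
  exact Prod.ext h5 h6

theorem IsSolution.exists_idempotent [Finite S] (hs : IsSolution s) (R : Set S) (hR : R.Nonempty)
    (hmul : ∀ x ∈ R, ∀ y ∈ R, x ⬝ y ∈ R) : ∃ e ∈ R, e ⬝ e = e := by
  let _ : Semigroup S := { mul := mul s, mul_assoc := hs.mul_assoc }
  let _ : TopologicalSpace S := ⊥
  have : DiscreteTopology S := ⟨rfl⟩
  exact exists_idempotent_in_compact_subsemigroup (fun _ => continuous_of_discreteTopology) R hR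
    (Set.toFinite R).isCompact hmul

theorem IsSolution.exists_eq_self [Finite S] (hs : IsSolution s) (x : S) :
    ∃ e t, e ⬝ e = e ∧ e = x ⬝ t := by
  obtain ⟨e, ⟨t, rfl⟩, he⟩ := hs.exists_idempotent (Set.range (mul s x)) ⟨_, x, rfl⟩ (by
    rintro _ ⟨a, rfl⟩ _ ⟨b, rfl⟩
    exact ⟨a ⬝ (x ⬝ b), by simp only [hs.mul_assoc]⟩)
  exact ⟨_, t, he, rfl⟩

/-- Right ideals are prime from the left. -/
theorem mem_of_mul_mem [Finite S] {R : Set S} (hR : ∀ x ∈ R, ∀ y, x ⬝ y ∈ R) {x y : S}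
    (h : x ⬝ y ∈ R) : x ∈ R := by
  -- `s` injects `R × S` into itself, hence onto it by finiteness, so a pair with image in `R × S`
  -- already lies there.
  have himg : s '' (R ×ˢ Set.univ) = R ×ˢ Set.univ := by
    refine Set.eq_of_subset_of_ncard_le ?_ ?_ (Set.toFinite _)
    · rintro _ ⟨⟨a, b⟩, ⟨ha, -⟩, rfl⟩
      exact ⟨hR a ha b, trivial⟩
    · rw [Set.ncard_image_of_injective _ s.injective]
  have hmem : s (x, y) ∈ s '' (R ×ˢ Set.univ) := by
    rw [himg]
    exact ⟨h, trivial⟩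
  obtain ⟨p, hp, hps⟩ := hmem
  obtain rfl := s.injective hps
  exact hp.1

theorem IsSolution.exists_eq_mul_of_mul_eq [Finite S] (hs : IsSolution s) {e x y z : S}
    (h : x ⬝ y = e ⬝ z) : ∃ t, x = e ⬝ t := by
  have := mem_of_mul_mem (s := s) (R := Set.range (mul s e)) (x := x) (y := y) (by
    rintro _ ⟨a, rfl⟩ b
    exact ⟨a ⬝ b, (hs.mul_assoc _ _ _).symm⟩) ⟨z, h.symm⟩
  obtain ⟨t, ht⟩ := this
  exact ⟨t, ht.symm⟩

/-- A bijective solution `s` with a point `o` such that `(o, o)` is fixed by `s`. -/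
structure IsUnital (s : S × S ≃ S × S) (o : S) : Prop where
  sol : IsSolution s
  fixed : s (o, o) = (o, o)

variable {o : S}

namespace IsUnital

theorem dual (h : IsUnital s o) : IsUnital (dual s) o :=
  ⟨h.sol.dual, dual_apply_of_apply h.fixed⟩

variable (h : IsUnital s o)
include h

theorem mul_self : o ⬝ o = o := congrArg Prod.fst h.fixed

theorem theta_self : θ o o = o := congrArg Prod.snd h.fixed

theorem mul_mul_self (x : S) : o ⬝ (o ⬝ x) = o ⬝ x := by rw [← h.sol.mul_assoc, h.mul_self]

theorem theta_one_theta_one (y : S) : θ o (θ o y) = θ o y := by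
  have := h.sol.theta_theta o o y
  rwa [h.theta_self, h.mul_self] at this

variable [Finite S]

/-- Primality of `e ⬝ S` gives `e ⬝ o = o`. The mixed identities then evaluate `θ o (e ⋆ o)` both as
`e ⋆ o` and as `e`, and inverting `s` at `(o, e)` yields `o ⬝ e = o`. -/
theorem eq_of_idempotent {e : S} (he : e ⬝ e = e) (hoe : o ⬝ e = e) : e = o := by
  have heo : e ⬝ o = o := by
    obtain ⟨t, ht⟩ := h.sol.exists_eq_mul_of_mul_eq (show o ⬝ e = e ⬝ e by rw [hoe, he])
    rw [ht, ← h.sol.mul_assoc, he]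
  have h1 : ψ (θ e o) o = e := by
    have := dual_theta_theta_mul (s := s) e o
    rwa [heo] at this
  have h2 : θ o e = e := by
    have := h.sol.theta_comm o o (θ e o)
    rwa [h1, h.theta_self, h1] at this
  have h3 : ψ e e = o := by
    have := dual_theta_theta_mul (s := s) o e
    rwa [hoe, h2] at this
  have h4 : ψ e o = o := by
    have := h.sol.dual_theta_mul o e e
    rw [h2, he, hoe, h3] at this
    exact this.symm
  have h5 : θ o (e ⋆ o) = e ⋆ o := by
    have := h.sol.star_theta o o e
    rw [h.theta_self, h4, h.mul_self] at this
    exact this.symm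
  have h6 : θ o (e ⋆ o) = e := by
    have := theta_dual_theta_star (s := s) e o
    rwa [h4] at this
  have h7 := dual_theta_mul_star (s := s) e o
  rw [h4, ← h5, h6, hoe] at h7
  exact h7

/-- The right ideal of `o ⬝ x ⬝ o` contains an idempotent, which can only be `o`. -/
theorem exists_right_inv (x : S) : ∃ t, o ⬝ t = t ∧ o ⬝ x ⬝ t = o := by
  obtain ⟨e, t, he, het⟩ := h.sol.exists_eq_self (o ⬝ x ⬝ o)
  have hoe : e = o := h.eq_of_idempotent he (by
    rw [het]; simp only [h.sol.mul_assoc, h.mul_mul_self])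
  refine ⟨o ⬝ t, h.mul_mul_self t, ?_⟩
  rw [← h.sol.mul_assoc, ← het, hoe]

theorem exists_left_inv {g : S} (hg : o ⬝ g = g) : ∃ t, o ⬝ t = t ∧ g ⬝ t = o ∧ t ⬝ g = o := by
  obtain ⟨t, ht, hgt⟩ := h.exists_right_inv g
  rw [hg] at hgt
  refine ⟨t, ht, hgt, h.eq_of_idempotent ?_ ?_⟩
  · rw [h.sol.mul_assoc, ← h.sol.mul_assoc g, hgt, hg]
  · rw [← h.sol.mul_assoc, ht]

theorem mul_mul_one (x : S) : o ⬝ x ⬝ o = o ⬝ x := by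
  obtain ⟨t, ht, h1, h2⟩ := h.exists_left_inv (h.mul_mul_self x)
  calc o ⬝ x ⬝ o = o ⬝ x ⬝ (t ⬝ (o ⬝ x)) := by rw [h2]
    _ = o ⬝ x := by rw [← h.sol.mul_assoc, h1, h.mul_mul_self]

theorem one_mul_idempotent {e : S} (he : e ⬝ e = e) : o ⬝ e = o := by
  refine h.eq_of_idempotent ?_ (h.mul_mul_self e)
  rw [← h.sol.mul_assoc, h.mul_mul_one, h.sol.mul_assoc, he]

theorem idempotent_mul_one {e : S} (he : e ⬝ e = e) : e ⬝ o = e := by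
  obtain ⟨t, ht⟩ := h.sol.exists_eq_mul_of_mul_eq (show e ⬝ o = (e ⬝ o) ⬝ o by
    rw [h.sol.mul_assoc, h.mul_self])
  have h1 : o = o ⬝ t := by
    calc o = o ⬝ e := (h.one_mul_idempotent he).symm
      _ = o ⬝ e ⬝ o ⬝ t := by rw [h.sol.mul_assoc o, h.sol.mul_assoc o, ← ht]
      _ = o ⬝ t := by rw [h.one_mul_idempotent he, h.mul_self]
  rw [h.sol.mul_assoc, ← h1] at ht
  exact ht.symm

/-- Primality puts `x` in `e ⬝ S` for any idempotent `e` of `x ⬝ S`. From here on, `o ⬝ e = o` is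
the working form of idempotency. -/
theorem exists_eq_mul (x : S) : ∃ e g, o ⬝ e = o ∧ o ⬝ g = g ∧ x = e ⬝ g := by
  obtain ⟨e, t, he, het⟩ := h.sol.exists_eq_self x
  obtain ⟨g, hg⟩ := h.sol.exists_eq_mul_of_mul_eq (show x ⬝ t = e ⬝ e by rw [← het, he])
  refine ⟨e, o ⬝ g, h.one_mul_idempotent he, h.mul_mul_self g, ?_⟩
  rw [← h.sol.mul_assoc, h.idempotent_mul_one he, hg]

theorem mul_one (x : S) : x ⬝ o = x := by
  obtain ⟨e, g, -, hg, rfl⟩ := h.exists_eq_mul x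
  rw [h.sol.mul_assoc, ← hg, h.mul_mul_one]

theorem mul_idempotent (x : S) {e : S} (he : o ⬝ e = o) : x ⬝ e = x := by
  rw [← h.mul_one x, h.sol.mul_assoc, he]

theorem mul_right_cancel {x y g : S} (hg : o ⬝ g = g) (hxy : x ⬝ g = y ⬝ g) : x = y := by
  obtain ⟨t, -, hgt, -⟩ := h.exists_left_inv hg
  rw [← h.mul_one x, ← h.mul_one y, ← hgt, ← h.sol.mul_assoc, ← h.sol.mul_assoc, hxy]

theorem one_mul_mul (x y : S) : o ⬝ (x ⬝ y) = (o ⬝ x) ⬝ (o ⬝ y) := by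
  rw [← h.sol.mul_assoc (o ⬝ x), h.mul_one, h.sol.mul_assoc]

theorem one_mul_theta (x : S) {e : S} (he : o ⬝ e = o) : o ⬝ θ x e = o := by
  apply h.one_mul_idempotent
  have := h.sol.theta_mul x e e
  rwa [h.mul_idempotent _ he, h.mul_idempotent _ he, eq_comm] at this

theorem theta_mul (x : S) {e : S} (he : o ⬝ e = o) (y : S) : θ x (e ⬝ y) = θ x e ⬝ θ x y := by
  rw [h.sol.theta_mul, h.mul_idempotent _ he]

theorem theta_one_idempotent {e : S} (he : o ⬝ e = o) : θ o e = e := by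
  have : s (o, θ o e) = s (o, e) := by
    rw [apply_eq, apply_eq, h.theta_one_theta_one, h.one_mul_theta o he, he]
  exact congrArg Prod.snd (s.injective this)

/-- Expanding `θ t (g ⬝ t)` for the inverse `g` of `t` gives `g ⬝ θ o t = o`, so `θ o t` is also
inverse to `g`. -/
theorem theta_one_of_one_mul {t : S} (ht : o ⬝ t = t) : θ o t = t := by
  obtain ⟨g, hg, htg, hgt⟩ := h.exists_left_inv ht
  have h1 : θ t g = g := by
    have := theta_star_mul (s := s) t g
    rwa [htg, h.dual.mul_one] at this
  have h2 := h.one_mul_theta t h.mul_self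
  rw [← hgt, h.sol.theta_mul, h1, htg, hgt, ← h.sol.mul_assoc, hg] at h2
  have h3 : o ⬝ θ o t = θ o t := by
    have := h.theta_mul o h.mul_self t
    rwa [ht, h.theta_self, eq_comm] at this
  calc θ o t = t ⬝ g ⬝ θ o t := by rw [htg, h3]
    _ = t := by rw [h.sol.mul_assoc, h2, h.mul_one]

theorem theta_one (x : S) : θ o x = x := by
  obtain ⟨e, g, he, hg, rfl⟩ := h.exists_eq_mul x
  rw [h.theta_mul o he, h.theta_one_idempotent he, h.theta_one_of_one_mul hg]

/-- As `θ o` is the identity, `s (o, g) = (g, g)`; inverting shows that `g` is idempotent for `⋆`.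
-/
theorem one_star_of_one_mul {g : S} (hg : o ⬝ g = g) : o ⋆ g = o := by
  apply h.dual.one_mul_idempotent
  have := theta_star_mul (s := s) o g
  rwa [hg, h.theta_one] at this

theorem one_mul_of_one_star {a : S} (ha : o ⋆ a = a) : o ⬝ a = o :=
  -- `dual (dual s)` unfolds to `s`.
  h.dual.one_star_of_one_mul ha

theorem theta_one_star (x y : S) : θ (o ⋆ x) y = θ x y := by
  rw [h.sol.theta_star, h.theta_one]

theorem one_mul_theta_eq (x y : S) : o ⬝ θ x (o ⬝ y) = o ⬝ θ x y := by
  rw [h.theta_mul x h.mul_self, h.one_mul_mul, h.one_mul_theta x h.mul_self,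
    h.mul_mul_self]

theorem theta_mul_one_mul (x : S) {e : S} (he : o ⬝ e = o) (y : S) :
    θ x (e ⬝ y) = θ x e ⬝ (o ⬝ θ x y) := by
  rw [h.theta_mul x he, ← h.sol.mul_assoc, h.mul_one]

/-- With `c = o ⋆ e`, this splits an idempotent into its `X`-part `θ c e` and its `A`-part `c`. -/
theorem theta_star_self (c : S) {e : S} (he : o ⬝ e = o) : θ c e ⋆ c = e := by
  have := theta_star_mul (s := s) c e
  rwa [h.mul_idempotent c he] at this

/-- This makes `coact` a right action. -/
theorem one_star_one_star_mul (x z : S) : o ⋆ ((o ⋆ x) ⬝ z) = o ⋆ (x ⬝ z) := by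
  rw [h.sol.star_mul, h.dual.one_mul_mul, h.one_star_of_one_mul (h.mul_mul_self _),
    h.dual.mul_mul_self]

theorem one_star_star_mul (a b x : S) :
    o ⋆ ((a ⋆ b) ⬝ x) = (o ⋆ (a ⬝ (o ⬝ θ b x))) ⋆ (o ⋆ (b ⬝ x)) := by
  rw [h.sol.star_mul, h.dual.one_mul_mul, ← h.sol.mul_assoc a, h.mul_one]

theorem one_mul_star {d a : S} (hd : o ⬝ d = o) (ha : o ⋆ a = a) : o ⬝ (d ⋆ a) = o := by
  have h1 := dual_theta_mul_star (s := s) d a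
  have h2 : ψ d a = a := by
    have h3 : ψ (o ⬝ d) a = ψ d a := h.dual.theta_one_star d a
    rw [← h3, hd, h.dual.theta_one]
  have h3 := congrArg (mul s o) h1
  rwa [h2, h.one_mul_mul, h.one_mul_of_one_star ha, h.mul_mul_self] at h3

/-! ### The matched pair of a solution and the coordinates on `S`. -/

/-- The group of elements of the form `o ⬝ x`. -/
abbrev Carrier (s : S × S ≃ S × S) (o : S) : Type u := {g : S // mul s o g = g}

/-- The group structure on the elements of the form `o ⬝ x`. -/
@[reducible] noncomputable def group : Group (Carrier s o) :=
  let _ : Mul (Carrier s o) := ⟨fun x y => ⟨x.1 ⬝ y.1, by rw [h.one_mul_mul, x.2, y.2]⟩⟩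
  let _ : One (Carrier s o) := ⟨⟨o, h.mul_self⟩⟩
  let _ : Inv (Carrier s o) := ⟨fun x => ⟨_, (h.exists_left_inv x.2).choose_spec.1⟩⟩
  Group.ofLeftAxioms (fun x y z => Subtype.ext (h.sol.mul_assoc x.1 y.1 z.1))
    (fun x => Subtype.ext x.2)
    (fun x => Subtype.ext (h.exists_left_inv x.2).choose_spec.2.2)

/-- The action of `S` on `o ⬝ S`, restricting to one of the group `o ⋆ S`. -/
def act (_ : IsUnital s o) (a : S) (x : Carrier s o) : Carrier s o :=
  ⟨o ⬝ θ a x, IsUnital.mul_mul_self ‹_› _⟩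

/-- The right action of `S` on `o ⋆ S`. -/
def coact (_ : IsUnital s o) (x : S) (a : Carrier (Pentagon.dual s) o) :
    Carrier (Pentagon.dual s) o :=
  ⟨o ⋆ (a ⬝ x), (IsUnital.dual ‹_›).mul_mul_self _⟩

theorem act_star (a b : S) (x : Carrier s o) : h.act (a ⋆ b) x = h.act a (h.act b x) :=
  Subtype.ext (by
    change o ⬝ θ (a ⋆ b) x = o ⬝ θ a (o ⬝ θ b x)
    rw [h.sol.theta_star, h.one_mul_theta_eq])

theorem act_one (x : Carrier s o) : h.act o x = x :=
  Subtype.ext (by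
    change o ⬝ θ o x = x
    rw [h.theta_one, x.2])

theorem coact_mul (x y : S) (a : Carrier (Pentagon.dual s) o) :
    h.coact (x ⬝ y) a = h.coact y (h.coact x a) :=
  Subtype.ext (by
    change o ⋆ (a ⬝ (x ⬝ y)) = o ⋆ ((o ⋆ (a ⬝ x)) ⬝ y)
    rw [h.one_star_one_star_mul, h.sol.mul_assoc])

theorem coact_one (a : Carrier (Pentagon.dual s) o) : h.coact o a = a :=
  Subtype.ext (by
    change o ⋆ (a ⬝ o) = a
    rw [h.mul_one, a.2])

/-- The matched pair of groups `(o ⋆ S, o ⬝ S)`. -/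
noncomputable def matchedPair :
    @MatchedPair (Carrier (Pentagon.dual s) o) (Carrier s o) h.dual.group h.group :=
  let _ := h.dual.group
  let _ := h.group
  { σ := fun a =>
      { toFun := h.act a
        invFun := h.act (a⁻¹ : Carrier (Pentagon.dual s) o)
        left_inv := fun x => by
          have key : (a⁻¹ : Carrier (Pentagon.dual s) o).1 ⋆ a.1 = o :=
            congrArg Subtype.val (inv_mul_cancel a)
          rw [← h.act_star, key, h.act_one]
        right_inv := fun x => by
          have key : a.1 ⋆ (a⁻¹ : Carrier (Pentagon.dual s) o).1 = o :=
            congrArg Subtype.val (mul_inv_cancel a)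
          rw [← h.act_star, key, h.act_one] }
    δ := fun x =>
      { toFun := h.coact x
        invFun := h.coact (x⁻¹ : Carrier s o)
        left_inv := fun a => by
          have key : x.1 ⬝ (x⁻¹ : Carrier s o).1 = o := congrArg Subtype.val (mul_inv_cancel x)
          rw [← h.coact_mul, key, h.coact_one]
        right_inv := fun a => by
          have key : (x⁻¹ : Carrier s o).1 ⬝ x.1 = o := congrArg Subtype.val (inv_mul_cancel x)
          rw [← h.coact_mul, key, h.coact_one] }
    σ_one := Equiv.ext h.act_one
    σ_mul := fun a b x => h.act_star a b x
    δ_one := Equiv.ext h.coact_one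
    δ_mul := fun x y a => h.coact_mul x y a
    σ_apply_mul := fun a x y => Subtype.ext (by
      change o ⬝ θ a (x ⬝ y) = (o ⬝ θ a x) ⬝ (o ⬝ θ (o ⋆ (a ⬝ x)) y)
      rw [h.sol.theta_mul, h.one_mul_mul, h.theta_one_star])
    δ_apply_mul := fun x a b => Subtype.ext (h.one_star_star_mul a b x) }

/-- A finite bijective solution is isomorphic to the one built from its matched pair. -/
theorem exists_isIso_ext :
    letI := h.dual.group
    letI := h.group
    Isomorphic s (h.matchedPair.ext (X := {d : S // o ⬝ d = o ∧ o ⋆ d = o}) 1) := by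
  let _ := h.dual.group
  let _ := h.group
  let F : {d : S // o ⬝ d = o ∧ o ⋆ d = o} × Carrier (Pentagon.dual s) o × Carrier s o → S :=
    fun p => (p.1.1 ⋆ p.2.1.1) ⬝ p.2.2.1
  have hE : ∀ p : {d : S // o ⬝ d = o ∧ o ⋆ d = o} × Carrier (Pentagon.dual s) o × Carrier s o,
      o ⬝ (p.1.1 ⋆ p.2.1.1) = o := fun p => h.one_mul_star p.1.2.1 p.2.1.2
  have hA : ∀ p : {d : S // o ⬝ d = o ∧ o ⋆ d = o} × Carrier (Pentagon.dual s) o × Carrier s o,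
      o ⋆ (p.1.1 ⋆ p.2.1.1) = p.2.1.1 := fun p => by
    rw [h.dual.one_mul_mul, p.1.2.2, h.dual.mul_mul_self, p.2.1.2]
  have hG : ∀ p, o ⬝ F p = p.2.2.1 := fun p => by
    rw [h.one_mul_mul, hE, h.mul_mul_self, p.2.2.2]
  -- On idempotents, `θ c` is right `⋆`-division by `c`. It changes only the `A`-coordinate, which
  -- is why the trivial `φ` suffices.
  have htheta : ∀ (c : Carrier (Pentagon.dual s) o) {e : S}, o ⬝ e = o →
      θ c e = e ⋆ (c⁻¹ : Carrier (Pentagon.dual s) o).1 := fun c e he => by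
    apply h.dual.mul_right_cancel c.2
    rw [h.theta_star_self _ he, h.dual.sol.mul_assoc]
    have : (c⁻¹ : Carrier (Pentagon.dual s) o).1 ⋆ c.1 = o := congrArg Subtype.val
      (inv_mul_cancel c)
    rw [this, h.dual.mul_one]
  have hFinj : Function.Injective F := fun p q hpq => by
    have h1 : p.2.2 = q.2.2 := Subtype.ext (by rw [← hG, ← hG, hpq])
    have h2 : p.1.1 ⋆ p.2.1.1 = q.1.1 ⋆ q.2.1.1 := by
      apply h.mul_right_cancel p.2.2.2
      conv_rhs => rw [h1]
      exact hpq
    have h3 : p.2.1 = q.2.1 := Subtype.ext ((hA p).symm.trans ((congrArg _ h2).trans (hA q)))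
    have h4 : p.1 = q.1 := Subtype.ext (by
      apply h.dual.mul_right_cancel p.2.1.2
      conv_rhs => rw [h3]
      exact h2)
    exact Prod.ext h4 (Prod.ext h3 h1)
  have hFsurj : Function.Surjective F := fun x => by
    obtain ⟨e, g, he, hg, rfl⟩ := h.exists_eq_mul x
    let c : Carrier (Pentagon.dual s) o := ⟨o ⋆ e, h.dual.mul_mul_self e⟩
    have hc : θ c e ⋆ c = e := h.theta_star_self c he
    refine ⟨(⟨θ c e, h.one_mul_theta _ he, ?_⟩, c, ⟨g, hg⟩), congrArg (· ⬝ g) hc⟩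
    rw [htheta c he, h.dual.one_mul_mul, (c⁻¹ : Carrier (Pentagon.dual s) o).2]
    exact congrArg Subtype.val (mul_inv_cancel c)
  let Φ := Equiv.ofBijective F ⟨hFinj, hFsurj⟩
  refine ⟨Φ.symm, Φ.symm.bijective, ?_⟩
  have hF : ∀ p q, s (F p, F q) = Prod.map F F (h.matchedPair.ext 1 (p, q)) := by
    intro p q
    refine Prod.ext ?_ ?_
    · change F p ⬝ F q = (p.1.1 ⋆ p.2.1.1) ⬝ (p.2.2.1 ⬝ q.2.2.1)
      have hmul : ∀ x y z : S, x ⬝ (y ⬝ (o ⬝ z)) = (x ⬝ y) ⬝ z := fun x y z => by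
        rw [← h.sol.mul_assoc y, h.mul_one, h.sol.mul_assoc]
      exact (congrArg (fun z => (p.1.1 ⋆ p.2.1.1) ⬝ (p.2.2.1 ⬝ z)) (hG q).symm |>.trans
        (hmul _ _ _)).symm
    · let c := h.coact p.2.2 p.2.1
      have hc : o ⋆ F p = c := by
        change o ⋆ F p = o ⋆ (p.2.1 ⬝ p.2.2)
        rw [← hA p, h.one_star_one_star_mul]
      change θ (F p) (F q) = (q.1.1 ⋆ (q.2.1.1 ⋆ (c⁻¹ : Carrier (Pentagon.dual s) o).1)) ⬝
        (o ⬝ θ c q.2.2)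
      rw [← h.theta_one_star, hc, h.theta_mul_one_mul _ (hE q), htheta _ (hE q),
        h.dual.sol.mul_assoc]
  funext ⟨x, y⟩
  obtain ⟨p, rfl⟩ := Φ.surjective x
  obtain ⟨q, rfl⟩ := Φ.surjective y
  change Prod.map Φ.symm Φ.symm (s (F p, F q)) = h.matchedPair.ext 1 (Φ.symm (Φ p), Φ.symm (Φ q))
  rw [hF]
  change (Φ.symm (Φ _), Φ.symm (Φ _)) = _
  simp only [Equiv.symm_apply_apply]
  rfl

end IsUnital

theorem IsSolution.exists_isUnital [Finite S] [Nonempty S] (hs : IsSolution s) :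
    ∃ e, e ⬝ e = e ∧ IsUnital s (θ e e) := by
  obtain ⟨e, -, he⟩ := hs.exists_idempotent Set.univ Set.univ_nonempty (fun _ _ _ _ => trivial)
  exact ⟨e, he, hs, hs.apply_theta_self he⟩

end Structure

theorem IsSolution.exists_isomorphic_ext {S : Type u} [Finite S] [Nonempty S]
    {s : S × S → S × S} (hs : IsSolution s) (hb : Function.Bijective s) :
    ∃ (A G : Type u) (_ : Group A) (_ : Group G) (M : MatchedPair A G)
      (X : Type u) (_ : Nonempty X) (φ : A → Equiv.Perm X), Isomorphic s (M.ext φ) := by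
  obtain ⟨e, -, h⟩ := IsSolution.exists_isUnital (s := Equiv.ofBijective s hb) hs
  exact ⟨_, _, h.dual.group, h.group, h.matchedPair, _, ⟨⟨_, h.mul_self, h.dual.mul_self⟩⟩, 1,
    h.exists_isIso_ext⟩

end Pentagon

namespace Pentagon

/-! ### Transport along homomorphisms and isomorphisms. -/

section Isomorphisms

variable {S : Type u} {T : Type v} {U : Type w} {s : S × S → S × S} {t : T × T → T × T}
  {r : U × U → U × U} {f : S → T}

theorem IsHom.map_mul (hf : IsHom s t f) (x y : S) : f (mul s x y) = mul t (f x) (f y) :=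
  congrArg Prod.fst (congrFun hf (x, y))

theorem IsHom.map_theta (hf : IsHom s t f) (x y : S) : f (theta s x y) = theta t (f x) (f y) :=
  congrArg Prod.snd (congrFun hf (x, y))

theorem IsHom.isSolution (hf : IsHom s t f) (hsurj : Function.Surjective f) (hs : IsSolution s) :
    IsSolution t := by
  have hap : ∀ x y, t (f x, f y) = (f (s (x, y)).1, f (s (x, y)).2) :=
    fun x y => (congrFun hf (x, y)).symm
  funext ⟨a, b, c⟩
  obtain ⟨x, rfl⟩ := hsurj a
  obtain ⟨y, rfl⟩ := hsurj b
  obtain ⟨z, rfl⟩ := hsurj c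
  have h := congrArg (Prod.map f (Prod.map f f)) (congrFun hs (x, y, z))
  simpa only [map12, map13, map23, Function.comp, hap, Prod.map] using h

theorem IsIso.bijective_of_bijective (hf : IsIso s t f) (ht : Function.Bijective t) :
    Function.Bijective s := by
  have h : Function.Bijective (Prod.map f f ∘ s) := by
    rw [show Prod.map f f ∘ s = _ from hf.2]
    exact ht.comp (hf.1.prodMap hf.1)
  exact (Function.Bijective.of_comp_iff' (hf.1.prodMap hf.1) s).1 h

theorem IsIso.exists_inverse (hf : IsIso s t f) :
    ∃ g : T → S, IsIso t s g ∧ Function.LeftInverse g f := by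
  let e := Equiv.ofBijective f hf.1
  refine ⟨e.symm, ⟨e.symm.bijective, ?_⟩, e.symm_apply_apply⟩
  funext ⟨a, b⟩
  apply (hf.1.prodMap hf.1).1
  have h := congrFun hf.2 (e.symm a, e.symm b)
  refine Eq.trans ?_ h.symm
  change (e (e.symm _), e (e.symm _)) = t (e (e.symm a), e (e.symm b))
  simp only [Equiv.apply_symm_apply]

theorem Isomorphic.symm (h : Isomorphic s t) : Isomorphic t s :=
  let ⟨_, hf⟩ := h
  let ⟨g, hg, _⟩ := hf.exists_inverse
  ⟨g, hg⟩

theorem Isomorphic.trans (h : Isomorphic s t) (h' : Isomorphic t r) : Isomorphic s r := by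
  obtain ⟨f, hf, hfs⟩ := h
  obtain ⟨g, hg, hgt⟩ := h'
  refine ⟨g ∘ f, hg.comp hf, ?_⟩
  funext p
  exact (congrArg (Prod.map g g) (congrFun hfs p)).trans (congrFun hgt (Prod.map f f p))

theorem IsHom.map_idempotent (hf : IsHom s t f) {e : S} (he : e ∈ idempotents s) :
    f e ∈ idempotents t := by
  change mul t (f e) (f e) = f e
  rw [← hf.map_mul, show mul s e e = e from he]

theorem IsIso.retractRel (hf : IsIso s t f) {e₀ x y : S} (h : RetractRel s e₀ x y) :
    RetractRel t (f e₀) (f x) (f y) := by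
  obtain ⟨e, he, e', he', g, hg, g', hg', rfl, rfl, hθ, rfl⟩ := h
  have hG : f g ∈ G₁ t (f e₀) := by
    obtain ⟨z, rfl⟩ := hg
    exact ⟨f z, by rw [hf.2.map_mul, hf.2.map_theta]⟩
  refine ⟨f e, hf.2.map_idempotent he, f e', hf.2.map_idempotent he', f g, hG, f g, hG,
    hf.2.map_mul _ _, hf.2.map_mul _ _, ?_, rfl⟩
  funext z
  obtain ⟨z, rfl⟩ := hf.1.2 z
  rw [← hf.2.map_theta, ← hf.2.map_theta, hθ]

theorem IsIso.retractRel_iff (hf : IsIso s t f) {e₀ x y : S} :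
    RetractRel s e₀ x y ↔ RetractRel t (f e₀) (f x) (f y) := by
  refine ⟨hf.retractRel, fun h => ?_⟩
  obtain ⟨g, hg, hgf⟩ := hf.exists_inverse
  have := hg.retractRel h
  rwa [hgf, hgf, hgf] at this

end Isomorphisms

/-! ### The solutions attached to a matched pair. -/

namespace MatchedPair

variable {A : Type v} {G : Type w} {A' : Type v'} {G' : Type w'} [Group A] [Group G]
  [Group A'] [Group G'] (M : MatchedPair A G) (M' : MatchedPair A' G')
  {X : Type x} {X' : Type x'} (φ : A → Equiv.Perm X) (φ' : A' → Equiv.Perm X')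

theorem σ_apply_one (a : A) : M.σ a 1 = 1 := by
  have h := M.σ_apply_mul a 1 1
  rwa [M.δ_one, mul_one, Equiv.Perm.one_apply, left_eq_mul] at h

theorem ext_apply (α β : X) (a b : A) (x y : G) :
    M.ext φ ((α, a, x), (β, b, y)) = ((α, a, x * y),
      ((φ (b * (M.δ x a)⁻¹)).symm (φ b β), b * (M.δ x a)⁻¹, M.σ (M.δ x a) y)) := rfl

theorem sol_apply (a b : A) (x y : G) :
    M.sol ((a, x), (b, y)) = ((a, x * y), (b * (M.δ x a)⁻¹, M.σ (M.δ x a) y)) := rfl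

theorem mul_ext (α β : X) (a b : A) (x y : G) :
    mul (M.ext φ) (α, a, x) (β, b, y) = (α, a, x * y) := rfl

theorem theta_ext (α β : X) (a b : A) (x y : G) :
    theta (M.ext φ) (α, a, x) (β, b, y) =
      ((φ (b * (M.δ x a)⁻¹)).symm (φ b β), b * (M.δ x a)⁻¹, M.σ (M.δ x a) y) := rfl

theorem ext_isSolution : IsSolution (M.ext φ) := by
  funext ⟨⟨α, a, x⟩, ⟨β, b, y⟩, ⟨γ, c, z⟩⟩
  -- This is `δ_apply_mul` for `b = (b * (M.δ x a)⁻¹) * M.δ x a`.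
  have h : M.δ (M.σ (M.δ x a) y) (b * (M.δ x a)⁻¹) * M.δ (x * y) a = M.δ y b := by
    rw [M.δ_mul, ← M.δ_apply_mul, inv_mul_cancel_right]
  simp only [map12, map13, map23, Function.comp, ext_apply, Prod.mk.injEq, true_and,
    Equiv.apply_symm_apply, mul_assoc, ← mul_inv_rev, ← M.σ_mul, M.δ_mul, M.σ_apply_mul]
  simp [← M.δ_mul, h]

theorem ext_bijective : Function.Bijective (M.ext φ) := by
  constructor
  · rintro ⟨⟨α, a, x⟩, ⟨β, b, y⟩⟩ ⟨⟨α', a', x'⟩, ⟨β', b', y'⟩⟩ h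
    simp only [ext_apply, Prod.mk.injEq] at h
    obtain ⟨⟨rfl, rfl, hxy⟩, hβ, hb, hy⟩ := h
    have h1 := M.σ_apply_mul a x y
    rw [hxy, M.σ_apply_mul, hy, mul_left_inj] at h1
    obtain rfl := (M.σ a).injective h1
    obtain rfl := mul_left_cancel hxy
    obtain rfl := mul_right_cancel hb
    simpa using hβ
  · rintro ⟨⟨α, a, z⟩, ⟨β, b, w⟩⟩
    -- The value of `x` is forced: `M.σ a z = M.σ a x * w` must hold when `z = x * y`.
    obtain ⟨x, hx⟩ := (M.σ a).surjective (M.σ a z * w⁻¹)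
    have h : M.σ (M.δ x a) (x⁻¹ * z) = w := by
      have h1 := M.σ_apply_mul a x (x⁻¹ * z)
      rw [mul_inv_cancel_left, hx, mul_assoc, left_eq_mul, inv_mul_eq_one] at h1
      exact h1.symm
    refine ⟨((α, a, x), ((φ (b * M.δ x a)).symm (φ b β), b * M.δ x a, x⁻¹ * z)), ?_⟩
    simp [ext_apply, h]

theorem sol_bijective : Function.Bijective M.sol :=
  IsIso.bijective_of_bijective (t := M.ext (X := Unit) 1) (f := fun p => ((), p))
    ⟨⟨fun _ _ h => (Prod.ext_iff.1 h).2, fun p => ⟨p.2, rfl⟩⟩, rfl⟩ (M.ext_bijective 1)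

theorem mem_idempotents_ext {p : X × A × G} : p ∈ idempotents (M.ext φ) ↔ p.2.2 = 1 := by
  obtain ⟨α, a, x⟩ := p
  change (α, a, x * x) = (α, a, x) ↔ x = 1
  simp

theorem mem_idempotents_sol {p : A × G} : p ∈ idempotents M.sol ↔ p.2 = 1 := by
  obtain ⟨a, x⟩ := p
  change (a, x * x) = (a, x) ↔ x = 1
  simp

/-- Idempotents are the `(α, a, 1)`, and `θ` of such a point divides by `a` on the `A`-coordinate,
so it detects `a` but not `α`. `G₁` is a copy of `G` with the other two coordinates fixed. -/
theorem retractRel_ext_iff {e₀ : X × A × G} (he₀ : e₀ ∈ idempotents (M.ext φ))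
    {p q : X × A × G} : RetractRel (M.ext φ) e₀ p q ↔ p.2 = q.2 := by
  obtain ⟨α₀, a₀, x₀⟩ := e₀
  obtain rfl : x₀ = 1 := (M.mem_idempotents_ext φ).1 he₀
  have hG : ∀ q, q ∈ G₁ (M.ext φ) (α₀, a₀, 1) ↔ ∃ x, q = ((φ 1).symm (φ a₀ α₀), 1, x) := by
    intro q
    have h1 : theta (M.ext φ) (α₀, a₀, 1) (α₀, a₀, 1) = ((φ 1).symm (φ a₀ α₀), 1, 1) := by
      rw [theta_ext, M.δ_one, Equiv.Perm.one_apply, mul_inv_cancel, σ_apply_one]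
    rw [G₁, h1]
    constructor
    · rintro ⟨⟨β, b, y⟩, rfl⟩
      exact ⟨y, by rw [mul_ext, one_mul]⟩
    · rintro ⟨x, rfl⟩
      exact ⟨((φ 1).symm (φ a₀ α₀), 1, x), by rw [mul_ext, one_mul]⟩
  constructor
  · rintro ⟨⟨α, a, x⟩, he, ⟨β, b, y⟩, hf, g, hg, h, hh, rfl, rfl, hθ, rfl⟩
    obtain rfl : x = 1 := (M.mem_idempotents_ext φ).1 he
    obtain rfl : y = 1 := (M.mem_idempotents_ext φ).1 hf
    have h1 := congrArg (fun p => p.2.1) (congrFun hθ (α, 1, 1))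
    simp only [theta_ext, M.δ_one, Equiv.Perm.one_apply, one_mul, inv_inj] at h1
    subst h1
    rfl
  · obtain ⟨α, a, x⟩ := p
    obtain ⟨β, b, y⟩ := q
    rintro ⟨⟩
    refine ⟨(α, a, 1), (M.mem_idempotents_ext φ).2 rfl, (β, a, 1),
      (M.mem_idempotents_ext φ).2 rfl, _, (hG _).2 ⟨x, rfl⟩, _, (hG _).2 ⟨x, rfl⟩, ?_, ?_, rfl, rfl⟩
    · rw [mul_ext, one_mul]
    · rw [mul_ext, one_mul]

variable {M M'}

/-- The isomorphism fixes the unit and preserves idempotents, and `(a, x)` is the product of `(a,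
1)` and `(1, x)`; so it is a product map `f₁ × f₂`. Compatibility with `θ` yields division in `A`
and both actions. -/
theorem Isomorphic.of_sol (h : Pentagon.Isomorphic M.sol M'.sol) : M.Isomorphic M' := by
  obtain ⟨f, hf, hs⟩ := h
  -- Every idempotent `(b, 1)` is sent to `(1, 1)` by its own `θ`.
  have hone : f (1, 1) = (1, 1) := by
    have h2 : theta M.sol (1, 1) (1, 1) = (1, 1) := by
      simp [theta, sol_apply, M.δ_one, σ_apply_one]
    have h3 : (f (1, 1)).2 = 1 := M'.mem_idempotents_sol.1 (hs.map_idempotent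
      (M.mem_idempotents_sol.2 rfl))
    rw [← h2, hs.map_theta]
    obtain ⟨b, hb⟩ : ∃ b, f (1, 1) = (b, 1) := ⟨_, Prod.ext rfl h3⟩
    simp [hb, theta, sol_apply, M'.δ_one, σ_apply_one]
  have hA : ∀ a, f (a, 1) = ((f (a, 1)).1, 1) := fun a =>
    Prod.ext rfl (M'.mem_idempotents_sol.1 (hs.map_idempotent (M.mem_idempotents_sol.2 rfl)))
  have hmul : ∀ a x, f (a, x) = ((f (a, 1)).1, (f (a, 1)).2 * (f (1, x)).2) := fun a x => by
    have := hs.map_mul (a, 1) (1, x)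
    simpa [mul, sol] using this
  have hG : ∀ x, f (1, x) = (1, (f (1, x)).2) := fun x => by
    have := hmul 1 x
    rw [hone] at this
    simpa using this
  have hf' : ∀ a x, f (a, x) = ((f (a, 1)).1, (f (1, x)).2) := fun a x => by
    rw [hmul, hA, one_mul]
  have hmulG : ∀ x y, (f (1, x * y)).2 = (f (1, x)).2 * (f (1, y)).2 := fun x y => by
    have := congrArg Prod.snd (hs.map_mul (1, x) (1, y))
    simpa [mul, sol] using this
  have hθ : ∀ a b x y, ((f (b * (M.δ x a)⁻¹, 1)).1, (f (1, M.σ (M.δ x a) y)).2) =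
      ((f (b, 1)).1 * (M'.δ (f (1, x)).2 (f (a, 1)).1)⁻¹,
        M'.σ (M'.δ (f (1, x)).2 (f (a, 1)).1) (f (1, y)).2) := fun a b x y => by
    have := hs.map_theta (a, x) (b, y)
    rwa [hf' a x, hf' b y, show theta M.sol (a, x) (b, y) =
      (b * (M.δ x a)⁻¹, M.σ (M.δ x a) y) from rfl, hf'] at this
  have hdiv : ∀ a b, (f (b * a⁻¹, 1)).1 = (f (b, 1)).1 * ((f (a, 1)).1)⁻¹ := fun a b => by
    have := congrArg Prod.fst (hθ a b 1 1)
    simpa [M.δ_one, hone, M'.δ_one] using this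
  let f₁ : A →* A' := MonoidHom.ofMapMulInv (fun a => (f (a, 1)).1) (fun a b => hdiv b a)
  let f₂ : G →* G' := MonoidHom.mk' (fun x => (f (1, x)).2) hmulG
  have hb₁ : Function.Bijective f₁ := by
    refine ⟨fun a b hab => ?_, fun a' => ?_⟩
    · have : f (a, 1) = f (b, 1) := by rw [hA a, hA b]; exact congrArg (·, 1) hab
      exact congrArg Prod.fst (hf.1 this)
    · obtain ⟨⟨a, x⟩, h⟩ := hf.2 (a', 1)
      rw [hf'] at h
      exact ⟨a, congrArg Prod.fst h⟩
  have hb₂ : Function.Bijective f₂ := by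
    refine ⟨fun x y hxy => ?_, fun x' => ?_⟩
    · have : f (1, x) = f (1, y) := by rw [hG x, hG y]; exact congrArg (1, ·) hxy
      exact congrArg Prod.snd (hf.1 this)
    · obtain ⟨⟨a, x⟩, h⟩ := hf.2 (1, x')
      rw [hf'] at h
      exact ⟨x, congrArg Prod.snd h⟩
  refine ⟨MulEquiv.ofBijective f₁ hb₁, MulEquiv.ofBijective f₂ hb₂, fun a x => ?_, fun a x => ?_⟩
  · have := congrArg Prod.snd (hθ a 1 1 x)
    simp only [M.δ_one, hone, M'.δ_one, Equiv.Perm.one_apply] at this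
    exact this
  · have := congrArg Prod.fst (hθ a 1 x 1)
    dsimp only at this
    rw [hdiv, hone, one_mul, one_mul, inv_inj] at this
    exact this

theorem Isomorphic.ext (h : M.Isomorphic M') (e : X ≃ X') :
    Pentagon.Isomorphic (M.ext φ) (M'.ext φ') := by
  obtain ⟨f₁, f₂, hσ, hδ⟩ := h
  -- Untwist by `φ`, apply `e`, then twist by `φ'`.
  refine ⟨fun p => ((φ' (f₁ p.2.1)).symm (e (φ p.2.1 p.1)), f₁ p.2.1, f₂ p.2.2), ⟨?_, ?_⟩, ?_⟩
  · rintro ⟨α, a, x⟩ ⟨β, b, y⟩ hp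
    simp only [Prod.mk.injEq, EmbeddingLike.apply_eq_iff_eq] at hp
    obtain ⟨h, rfl, rfl⟩ := hp
    simpa using h
  · rintro ⟨α, a, x⟩
    exact ⟨((φ (f₁.symm a)).symm (e.symm (φ' a α)), f₁.symm a, f₂.symm x), by simp⟩
  · funext ⟨⟨α, a, x⟩, ⟨β, b, y⟩⟩
    simp [ext_apply, hσ, hδ]

end MatchedPair

/-! ### Retracts as solutions on `A × G`. -/

section Retract

variable {S : Type u} {s : S × S → S × S} {e₀ : S} {A : Type v} {G : Type w} [Group A] [Group G]
  {M : MatchedPair A G} {X : Type x} {φ : A → Equiv.Perm X}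

theorem IsIso.retractRel_iff_snd {f : S → X × A × G} (hf : IsIso s (M.ext φ) f)
    (he₀ : e₀ ∈ idempotents s) {x y : S} : RetractRel s e₀ x y ↔ (f x).2 = (f y).2 := by
  rw [hf.retractRel_iff, M.retractRel_ext_iff φ (hf.2.map_idempotent he₀)]

theorem Isomorphic.retractRel_equivalence (h : Isomorphic s (M.ext φ))
    (he₀ : e₀ ∈ idempotents s) : Equivalence (RetractRel s e₀) := by
  obtain ⟨f, hf⟩ := h
  have := fun x y => hf.retractRel_iff_snd he₀ (x := x) (y := y)
  constructor <;> simp_all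

/-- The retract of a solution isomorphic to `M.ext φ` is in bijection with `A × G`. -/
theorem IsIso.exists_retract_equiv [Nonempty X] {f : S → X × A × G} (hf : IsIso s (M.ext φ) f)
    (he₀ : e₀ ∈ idempotents s) :
    ∃ π : Retract s e₀ ≃ A × G, ∀ x, π (Retract.proj s e₀ x) = (f x).2 := by
  let π : Retract s e₀ → A × G :=
    Quot.lift (fun x => (f x).2) fun _ _ h => (hf.retractRel_iff_snd he₀).1 h
  refine ⟨Equiv.ofBijective π ⟨?_, ?_⟩, fun _ => rfl⟩
  · rintro ⟨x⟩ ⟨y⟩ h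
    exact Quot.sound ((hf.retractRel_iff_snd he₀).2 h)
  · intro p
    obtain ⟨x, hx⟩ := hf.1.2 (Classical.arbitrary X, p)
    exact ⟨Retract.proj s e₀ x, congrArg Prod.snd hx⟩

variable [Nonempty X]

theorem Isomorphic.exists_retract_map (h : Isomorphic s (M.ext φ)) (he₀ : e₀ ∈ idempotents s) :
    ∃ sbar : Retract s e₀ × Retract s e₀ → Retract s e₀ × Retract s e₀,
      IsHom s sbar (Retract.proj s e₀) := by
  obtain ⟨f, hf⟩ := h
  obtain ⟨π, hπ⟩ := hf.exists_retract_equiv he₀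
  refine ⟨fun p => Prod.map π.symm π.symm (M.sol (Prod.map π π p)), ?_⟩
  funext ⟨x, y⟩
  apply (π.injective.prodMap π.injective)
  have h := congrArg (Prod.map Prod.snd Prod.snd) (congrFun hf.2 (x, y))
  simp only [Function.comp, Prod.map, hπ, Equiv.apply_symm_apply] at h ⊢
  exact h

theorem Isomorphic.retract (h : Isomorphic s (M.ext φ)) (he₀ : e₀ ∈ idempotents s)
    {sbar : Retract s e₀ × Retract s e₀ → Retract s e₀ × Retract s e₀}
    (hbar : IsHom s sbar (Retract.proj s e₀)) : Isomorphic sbar M.sol := by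
  obtain ⟨f, hf⟩ := h
  obtain ⟨π, hπ⟩ := hf.exists_retract_equiv he₀
  refine ⟨π, π.bijective, ?_⟩
  funext ⟨a, b⟩
  obtain ⟨x, rfl⟩ := Quot.exists_rep a
  obtain ⟨y, rfl⟩ := Quot.exists_rep b
  have h1 := congrArg (Prod.map Prod.snd Prod.snd) (congrFun hf.2 (x, y))
  have h2 := congrArg (Prod.map π π) (congrFun hbar (x, y))
  simp only [Function.comp, Prod.map, hπ] at h1 h2
  refine h2.symm.trans (h1.trans ?_)
  change M.sol ((f x).2, (f y).2) = M.sol (π (Retract.proj s e₀ x), π (Retract.proj s e₀ y))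
  rw [hπ, hπ]

/-- One retract is identified with both `M.sol` and `M'.sol`. -/
theorem MatchedPair.Isomorphic.of_ext {A' : Type v'} {G' : Type w'} [Group A'] [Group G']
    {M' : MatchedPair A' G'} {X' : Type x'} [Nonempty X'] {φ' : A' → Equiv.Perm X'}
    (h : Pentagon.Isomorphic (M.ext φ) (M'.ext φ')) : M.Isomorphic M' := by
  have he₀ : (Classical.arbitrary X, 1, 1) ∈ idempotents (M.ext φ) :=
    (M.mem_idempotents_ext φ).2 rfl
  have h0 : Pentagon.Isomorphic (M.ext φ) (M.ext φ) := h.trans h.symm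
  obtain ⟨sbar, hbar⟩ := h0.exists_retract_map he₀
  exact .of_sol ((h0.retract he₀ hbar).symm.trans (h.retract he₀ hbar))

end Retract

end Pentagon

/-! ### The classification theorem. -/

open Pentagon in
theorem theorem5p5 :
    -- every matched pair, nonempty set and family of permutations gives a bijective solution
    (∀ (A : Type v) (G : Type w) [Group A] [Group G] (M : MatchedPair A G)
        (X : Type x) [Nonempty X] (φ : A → Equiv.Perm X),
      IsSolution (M.ext φ) ∧ Function.Bijective (M.ext φ)) ∧
    -- every finite bijective solution arises in this way, the matched pair being the one
    -- determined by the retract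
    (∀ (S : Type u) [Finite S] [Nonempty S] (s : S × S → S × S),
      IsSolution s → Function.Bijective s →
      (idempotents s).Nonempty ∧
      ∀ e₀ ∈ idempotents s,
        Equivalence (RetractRel s e₀) ∧
        ∃ sbar : Retract s e₀ × Retract s e₀ → Retract s e₀ × Retract s e₀,
          IsHom s sbar (Retract.proj s e₀) ∧ IsSolution sbar ∧ Function.Bijective sbar ∧
          (∃ (A G : Type u) (_ : Group A) (_ : Group G) (M : MatchedPair A G)
              (X : Type u) (_ : Nonempty X) (φ : A → Equiv.Perm X),
            Isomorphic s (M.ext φ) ∧ Isomorphic sbar M.sol) ∧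
          (∀ (A : Type v) (G : Type w) [Group A] [Group G] (M : MatchedPair A G),
            (∃ (X : Type u) (_ : Nonempty X) (φ : A → Equiv.Perm X), Isomorphic s (M.ext φ)) ↔
              Isomorphic sbar M.sol) ∧
          (∀ (A : Type v) (G : Type w) (A' : Type v') (G' : Type w')
              [Group A] [Group G] [Group A'] [Group G']
              (M : MatchedPair A G) (M' : MatchedPair A' G'),
            Isomorphic sbar M.sol → Isomorphic sbar M'.sol → M.Isomorphic M')) ∧
    -- the isomorphism class is determined by the class of the matched pair and the size of `X`
    (∀ (S : Type u) (S' : Type u') [Finite S] [Finite S']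
        (s : S × S → S × S) (s' : S' × S' → S' × S'),
      IsSolution s → Function.Bijective s → IsSolution s' → Function.Bijective s' →
      ∀ (A : Type v) (G : Type w) (A' : Type v') (G' : Type w')
        [Group A] [Group G] [Group A'] [Group G']
        (M : MatchedPair A G) (M' : MatchedPair A' G')
        (X : Type x) (X' : Type x') [Nonempty X] [Nonempty X']
        (φ : A → Equiv.Perm X) (φ' : A' → Equiv.Perm X'),
      Isomorphic s (M.ext φ) → Isomorphic s' (M'.ext φ') →
        (Isomorphic s s' ↔ M.Isomorphic M' ∧ Nat.card X = Nat.card X')) := by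

  refine ⟨fun A G _ _ M X _ φ => ⟨M.ext_isSolution φ, M.ext_bijective φ⟩, ?_, ?_⟩
  · intro S _ _ s hs hb
    have hE : (idempotents s).Nonempty :=
      let ⟨e, he, _⟩ := IsSolution.exists_isUnital (s := Equiv.ofBijective s hb) hs
      ⟨e, he⟩
    obtain ⟨A₀, G₀, _, _, M₀, X₀, _, φ₀, h₀⟩ := hs.exists_isomorphic_ext hb
    refine ⟨hE, fun e₀ he₀ => ⟨h₀.retractRel_equivalence he₀, ?_⟩⟩
    obtain ⟨sbar, hbar⟩ := h₀.exists_retract_map he₀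
    have hret := h₀.retract he₀ hbar
    refine ⟨sbar, hbar, hbar.isSolution Quot.mk_surjective hs,
      let ⟨_, hf⟩ := hret; hf.bijective_of_bijective M₀.sol_bijective,
      ⟨A₀, G₀, _, _, M₀, X₀, ‹_›, φ₀, h₀, hret⟩, ?_, ?_⟩
    · intro A G _ _ M
      constructor
      · rintro ⟨X, _, φ, h⟩
        exact h.retract he₀ hbar
      · intro h
        have hM : M₀.Isomorphic M := .of_sol (hret.symm.trans h)
        -- The set `X₀` is kept; any family of permutations would do.
        exact ⟨X₀, ‹_›, 1, h₀.trans (hM.ext φ₀ 1 (Equiv.refl X₀))⟩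
    · intro A G A' G' _ _ _ _ M M' h h'
      exact .of_sol (h.symm.trans h')
  · intro S S' _ _ s s' _ _ _ _ A G A' G' _ _ _ _ M M' X X' _ _ φ φ' h h'
    have hfin : Finite (X × A × G) := let ⟨_, hf⟩ := h; Finite.of_surjective _ hf.1.2
    have hfin' : Finite (X' × A' × G') := let ⟨_, hf⟩ := h'; Finite.of_surjective _ hf.1.2
    have : Finite X := Finite.of_surjective Prod.fst (Prod.fst_surjective (β := A × G))
    have : Finite X' := Finite.of_surjective Prod.fst (Prod.fst_surjective (β := A' × G'))
    have hAG : Finite (A × G) := Finite.of_surjective Prod.snd (Prod.snd_surjective (α := X))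
    constructor
    · intro hss'
      have hext := h.symm.trans (hss'.trans h')
      have hM : M.Isomorphic M' := .of_ext hext
      refine ⟨hM, ?_⟩
      obtain ⟨f₁, f₂, -, -⟩ := hM
      obtain ⟨f, hf, -⟩ := hext
      have hcard := Nat.card_congr (Equiv.ofBijective f hf)
      rw [Nat.card_prod, Nat.card_prod X',
        ← Nat.card_congr (Equiv.prodCongr f₁.toEquiv f₂.toEquiv)] at hcard
      -- The common factor `Nat.card (A × G)` is nonzero because `hAG` makes `A × G` finite.
      exact Nat.eq_of_mul_eq_mul_right Nat.card_pos hcard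
    · rintro ⟨hM, hX⟩
      exact h.trans ((hM.ext φ φ' ((Finite.equivFinOfCardEq hX).trans (Finite.equivFin X').symm)).trans h'.symm)
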